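/- **Setting.** All manifolds are smooth, connected, Hausdorff, paracompact, without boundary and of one fixed dimension $n$. Let $(M,g)$ be a time-oriented Lorentzian manifold. Let $\mathcal C$ be a family of $C^1$ curves $\gamma:[a,b)\to M$ ($a<b\le\infty$) with the bounded parameter property: (i) through every point of $M$ passes a curve of $\mathcal C$; (ii) every restriction of a $\gamma\in\mathcal C$ to some $[a',b')\subset[a,b)$ is in $\mathcal C$; (iii) if $\gamma,\tilde\gamma\in\mathcal C$ (defined on $[a,b)$ and $[\tilde a,\tilde b)$) are related by an increasing change of parameter, then $b,\tilde b$ are both finite (bounded parameter) or both infinite (unbounded parameter). **Abstract boundary.** An *envelopment* is a smooth embedding $\phi:M\to\widehat M$ into a manifold of the same dimension; a *boundary set* is a nonempty $B\subset\partial\phi(M)$, and a *boundary point* is a point of $\partial\phi(M)$. A boundary set $B\subset\partial\phi(M)$ *covers* $B'\subset\partial\phi'(M)$ if each neighbourhood $N$ of $B$ admits a neighbourhood $N'$ of $B'$ with $\phi\circ\phi'^{-1}(N'\cap\phi'(M))\subset N$. Boundary sets are equivalent if each covers the other, and $\mathcal B(M)$ is the set of equivalence classes $[p]$ of singletons $\{p\}$.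 A curve $\gamma$ *approaches* $p\in\partial\phi(M)$ if $p$ is a limit point of $\phi(\gamma(t))$ as $t\to b$. A boundary point is a *point at infinity* if some curve of $\mathcal C$ approaches it and every curve of $\mathcal C$ approaching it has unbounded parameter; it is *singular* if some curve of $\mathcal C$ with bounded parameter approaches it; it is a *pure singularity* if it is singular and covers no point at infinity (of any envelopment). These notions pass to $\mathcal B(M)$. A boundary set $B\subset\partial\phi(M)$ is *strongly attached* to an open $U\subset M$ if there is an open $N\supset B$ in $\widehat M$ with $N\cap\phi(M)\subset\phi(U)$; this also passes to $\mathcal B(M)$. The *strongly attached point topology* on $\overline M=M\cup\mathcal B(M)$ has as basis the sets $U\cup\{x\in\mathcal B(M): x\text{ strongly attached to }U\}$, $U\subset M$ open. **Black region.** A *singular neighbourhood* is an open $U\subset M$ to which every pure singularity in $\mathcal B(M)$ is strongly attached. A closed $A\subset M$ is *singularly compact* if $A\setminus U$ is compact for every singular neighbourhood $U$. The *black region* $\mathscr B\subset M$ is the union of all singularly compact $A$ with $J^+(A)=A$. **Theorem.** Let $(M,g)$ be strongly causal and let $p\in\mathscr B$. Let $\sigma:[a,b)\to M$ ($a<b\le\infty$)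 be a future-directed causal curve through $p$ that is inextendible, i.e. $\sigma(t)$ has no limit in $M$ as $t\to b$, and let $(t_k)$ be a sequence in $[a,b)$ with $t_k\to b$. Then the sequence $(\sigma(t_k))$ has a pure singularity as an accumulation point in $\overline M$: there is a pure singularity $x\in\mathcal B(M)$ such that every neighbourhood of $x$ in $\overline M$ contains $\sigma(t_k)$ for infinitely many $k$. -/

import Mathlib

open Set Filter Topology Manifold
open scoped ContDiff

universe u

/-! ### Spacetimes -/

section Spacetime

/-- A Lorentzian metric of class `C^r` on an `n`-dimensional manifold: a symmetric `C^r` tensor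
field of type `(0,2)` whose value at every point has signature `(-,+,…,+)`, that is, there is a
vector on which it is negative and on whose orthogonal complement it is positive definite. -/
structure LorentzMetric (n : ℕ) (r : ℕ∞) (M : Type*) [TopologicalSpace M]
    [ChartedSpace (EuclideanSpace ℝ (Fin n)) M] [IsManifold (𝓡 n) ∞ M] where
  inner (x : M) : TangentSpace (𝓡 n) x →L[ℝ] TangentSpace (𝓡 n) x →L[ℝ] ℝ
  symm (x : M) (v w : TangentSpace (𝓡 n) x) : inner x v w = inner x w v
  signature (x : M) : ∃ v : TangentSpace (𝓡 n) x, inner x v v < 0 ∧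
    ∀ w : TangentSpace (𝓡 n) x, w ≠ 0 → inner x v w = 0 → 0 < inner x w w
  contMDiff : ContMDiff (𝓡 n)
    ((𝓡 n).prod 𝓘(ℝ, EuclideanSpace ℝ (Fin n) →L[ℝ] EuclideanSpace ℝ (Fin n) →L[ℝ] ℝ)) (r : ℕ∞ω)
    (fun x ↦ Bundle.TotalSpace.mk'
      (EuclideanSpace ℝ (Fin n) →L[ℝ] EuclideanSpace ℝ (Fin n) →L[ℝ] ℝ)
      (E := fun x : M ↦ TangentSpace (𝓡 n) x →L[ℝ] TangentSpace (𝓡 n) x →L[ℝ] ℝ) x (inner x))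

variable {n : ℕ} {r : ℕ∞} {M : Type*} [TopologicalSpace M]
  [ChartedSpace (EuclideanSpace ℝ (Fin n)) M] [IsManifold (𝓡 n) ∞ M]

/-- A time orientation, given by a continuous timelike vector field. -/
structure TimeOrientation (g : LorentzMetric n r M) where
  field (x : M) : TangentSpace (𝓡 n) x
  timelike (x : M) : g.inner x (field x) (field x) < 0
  continuous : Continuous fun x ↦ (⟨x, field x⟩ : TangentBundle (𝓡 n) M)

/-- A tangent vector is future-directed causal if it is nonzero, timelike or null, and lies in the
same half of the cone as the time orientation. -/
def IsFutureCausalVector {g : LorentzMetric n r M} (τ : TimeOrientation g) (x : M)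
    (v : TangentSpace (𝓡 n) x) : Prop :=
  v ≠ 0 ∧ g.inner x v v ≤ 0 ∧ g.inner x v (τ.field x) < 0

/-- `σ` restricted to the interval `s` is a future-directed causal curve: it is continuous and
piecewise `C^1` (the set `F` of break points is locally finite in `s`), and on each `C^1` piece
its tangent vectors, one-sided at the end points of the piece, are future-directed causal. -/
def IsFutureCausalOn {g : LorentzMetric n r M} (τ : TimeOrientation g) (σ : ℝ → M)
    (s : Set ℝ) : Prop :=
  ContinuousOn σ s ∧ ∃ F : Set ℝ,
    (∀ c ∈ s, ∀ d ∈ s, (F ∩ Icc c d).Finite) ∧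
    ∀ c ∈ s, ∀ d ∈ s, c < d → Disjoint (Ioo c d) F →
      ContMDiffOn 𝓘(ℝ, ℝ) (𝓡 n) 1 σ (Icc c d) ∧
      ∀ t ∈ Icc c d, IsFutureCausalVector τ (σ t)
        (mfderivWithin 𝓘(ℝ, ℝ) (𝓡 n) σ (Icc c d) t (1 : ℝ))

/-- The causal future `J⁺(A)`: the points of `A` and all end points of future-directed causal
curves that start in `A`. -/
def causalFuture {g : LorentzMetric n r M} (τ : TimeOrientation g) (A : Set M) : Set M :=
  {q | ∃ p ∈ A, q = p ∨ ∃ (σ : ℝ → M) (c d : ℝ), c < d ∧ IsFutureCausalOn τ σ (Icc c d) ∧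
    σ c = p ∧ σ d = q}

/-- Strong causality: at every `p`, each neighbourhood `U` of `p` contains a neighbourhood `V` of
`p` such that every causal curve segment with end points in `V` stays in `U`. -/
def IsStronglyCausal {g : LorentzMetric n r M} (τ : TimeOrientation g) : Prop :=
  ∀ p : M, ∀ U ∈ 𝓝 p, ∃ V ∈ 𝓝 p, V ⊆ U ∧
    ∀ (σ : ℝ → M) (c d : ℝ), c < d → IsFutureCausalOn τ σ (Icc c d) →
      σ c ∈ V → σ d ∈ V → ∀ t ∈ Icc c d, σ t ∈ U

end Spacetime

/-! ### Parametrised curves -/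

section Curves

/-- The interval `[a,b)`, where `b` may be `∞`. -/
def halfOpen (a : ℝ) (b : EReal) : Set ℝ := {t | a ≤ t ∧ (t : EReal) < b}

/-- A map `[a,b) → M` with `a < b ≤ ∞`. -/
structure ParamCurve (M : Type*) where
  a : ℝ
  b : EReal
  lt : (a : EReal) < b
  toFun : halfOpen a b → M

namespace ParamCurve

variable {M : Type*}

/-- The parameter interval `[a,b)`. -/
abbrev dom (γ : ParamCurve M) : Set ℝ := halfOpen γ.a γ.b

instance : CoeFun (ParamCurve M) (fun γ ↦ γ.dom → M) := ⟨fun γ ↦ γ.toFun⟩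

open Classical in
/-- The curve as a function on `ℝ`; only the values on `[a,b)` matter, and the function is given
the constant value `γ a` elsewhere. -/
noncomputable def ext (γ : ParamCurve M) (t : ℝ) : M :=
  if h : t ∈ γ.dom then γ ⟨t, h⟩ else γ ⟨γ.a, le_refl _, γ.lt⟩

/-- The filter "`t → b` in `[a,b)`". -/
noncomputable def toEnd (γ : ParamCurve M) : Filter γ.dom :=
  comap (fun t : γ.dom ↦ ((t : ℝ) : EReal)) (𝓝 γ.b)

/-- The restriction of a curve to `[a',b') ⊆ [a,b)`. -/
def restrict (γ : ParamCurve M) (a' : ℝ) (b' : EReal) (h : (a' : EReal) < b')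
    (ha : γ.a ≤ a') (hb : b' ≤ γ.b) : ParamCurve M where
  a := a'
  b := b'
  lt := h
  toFun t := γ ⟨t, ha.trans t.2.1, t.2.2.trans_le hb⟩

/-- `γ` arises from `γ'` by an increasing (`C^1`) change of parameter. -/
def IsReparam (γ γ' : ParamCurve M) : Prop :=
  ∃ s : γ.dom → γ'.dom, StrictMono s ∧ Function.Surjective s ∧
    (∃ s' : ℝ → ℝ, ContDiffOn ℝ 1 s' γ.dom ∧ ∀ t : γ.dom, s' t = s t) ∧
    ∀ t : γ.dom, γ t = γ' (s t)

/-- The parameter is bounded: `b < ∞`. -/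
def HasBoundedParameter (γ : ParamCurve M) : Prop := γ.b ≠ ⊤

/-- A curve `[a,b) → M` has no (future) end point: `γ t` has no limit in `M` as `t → b`. -/
def IsInextendible [TopologicalSpace M] (γ : ParamCurve M) : Prop :=
  ∀ q : M, ¬ Tendsto γ γ.toEnd (𝓝 q)

end ParamCurve

/-- A family of `C^1` curves `[a,b) → M` with the bounded parameter property. -/
structure HasBoundedParameterProperty (n : ℕ) {M : Type*} [TopologicalSpace M]
    [ChartedSpace (EuclideanSpace ℝ (Fin n)) M] (C : Set (ParamCurve M)) : Prop where
  contMDiff : ∀ γ ∈ C, ContMDiffOn 𝓘(ℝ, ℝ) (𝓡 n) 1 γ.ext γ.dom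
  through : ∀ p : M, ∃ γ ∈ C, ∃ t : γ.dom, γ t = p
  subcurve : ∀ γ ∈ C, ∀ (a' : ℝ) (b' : EReal) (h : (a' : EReal) < b') (ha : γ.a ≤ a')
    (hb : b' ≤ γ.b), γ.restrict a' b' h ha hb ∈ C
  bounded_iff : ∀ γ ∈ C, ∀ γ' ∈ C, γ.IsReparam γ' →
    (γ.HasBoundedParameter ↔ γ'.HasBoundedParameter)

end Curves

/-! ### The abstract boundary -/

section AbstractBoundary

/-- An envelopment of the `n`-manifold `M`: a smooth embedding into a (connected, Hausdorff,
paracompact) smooth manifold of the same dimension. Such a manifold has at most the cardinality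
of the continuum, so up to diffeomorphism all of them live in the universe of `M`. -/
structure Envelopment (n : ℕ) (M : Type u) [TopologicalSpace M]
    [ChartedSpace (EuclideanSpace ℝ (Fin n)) M] where
  carrier : Type u
  [top : TopologicalSpace carrier]
  [charted : ChartedSpace (EuclideanSpace ℝ (Fin n)) carrier]
  [manifold : IsManifold (𝓡 n) ∞ carrier]
  [connected : ConnectedSpace carrier]
  [t2 : T2Space carrier]
  [paracompact : ParacompactSpace carrier]
  map : M → carrier
  smoothEmbedding : IsSmoothEmbedding (𝓡 n) (𝓡 n) ∞ map

attribute [instance] Envelopment.top Envelopment.charted Envelopment.manifold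
  Envelopment.connected Envelopment.t2 Envelopment.paracompact

variable {n : ℕ} {M : Type u} [TopologicalSpace M] [ChartedSpace (EuclideanSpace ℝ (Fin n)) M]

variable (n M) in
/-- A boundary set: a nonempty subset of `∂φ(M)` for an envelopment `φ`. -/
structure BoundarySet where
  env : Envelopment n M
  set : Set env.carrier
  nonempty : set.Nonempty
  subset : set ⊆ frontier (range env.map)

variable (n M) in
/-- A boundary point: a point of `∂φ(M)` for an envelopment `φ`. -/
structure BoundaryPoint where
  env : Envelopment n M
  pt : env.carrier
  mem : pt ∈ frontier (range env.map)

/-- The boundary set `{p}`. -/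
def BoundaryPoint.toSet (p : BoundaryPoint n M) : BoundarySet n M where
  env := p.env
  set := {p.pt}
  nonempty := singleton_nonempty _
  subset := singleton_subset_iff.2 p.mem

/-- `B` covers `B'`: each neighbourhood `N` of `B` admits a neighbourhood `N'` of `B'` with
`φ ∘ φ'⁻¹ (N' ∩ φ'(M)) ⊆ N`. -/
def BoundarySet.Covers (B B' : BoundarySet n M) : Prop :=
  ∀ N ∈ 𝓝ˢ B.set, ∃ N' ∈ 𝓝ˢ B'.set, B.env.map '' (B'.env.map ⁻¹' N') ⊆ N

theorem BoundarySet.Covers.refl (B : BoundarySet n M) : B.Covers B :=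
  fun N hN ↦ ⟨N, hN, image_preimage_subset _ _⟩

theorem BoundarySet.Covers.trans {B₁ B₂ B₃ : BoundarySet n M} (h : B₁.Covers B₂)
    (h' : B₂.Covers B₃) : B₁.Covers B₃ := by
  intro N hN
  obtain ⟨N₂, hN₂, h₂⟩ := h N hN
  obtain ⟨N₃, hN₃, h₃⟩ := h' N₂ hN₂
  refine ⟨N₃, hN₃, ?_⟩
  rintro _ ⟨x, hx, rfl⟩
  exact h₂ ⟨x, h₃ ⟨x, hx, rfl⟩, rfl⟩

variable (n M) in
/-- Boundary sets are equivalent if they cover each other. -/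
instance BoundarySet.setoid : Setoid (BoundarySet n M) where
  r B B' := B.Covers B' ∧ B'.Covers B
  iseqv :=
    { refl := fun B ↦ And.intro (.refl B) (.refl B)
      symm := And.symm
      trans := by
        rintro _ _ _ ⟨h₁, h₂⟩ ⟨h₃, h₄⟩
        exact ⟨h₁.trans h₃, h₄.trans h₂⟩ }

variable (n M) in
/-- The abstract boundary: the equivalence classes of boundary sets that contain a singleton. -/
def AbstractBoundary : Type (u + 1) :=
  {c : Quotient (BoundarySet.setoid n M) // ∃ p : BoundaryPoint n M, c = ⟦p.toSet⟧}

/-- The abstract boundary point `[p]`. -/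
def BoundaryPoint.toAbstract (p : BoundaryPoint n M) : AbstractBoundary n M :=
  ⟨⟦p.toSet⟧, p, rfl⟩

/-- `B` is strongly attached to `U`: there is an open `N ⊇ B` with `N ∩ φ(M) ⊆ φ(U)`. -/
def BoundarySet.StronglyAttached (B : BoundarySet n M) (U : Set M) : Prop :=
  ∃ N : Set B.env.carrier, IsOpen N ∧ B.set ⊆ N ∧ N ∩ range B.env.map ⊆ B.env.map '' U

theorem BoundarySet.StronglyAttached.of_covers {B B' : BoundarySet n M} {U : Set M}
    (h : B.StronglyAttached U) (hc : B.Covers B') : B'.StronglyAttached U := by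
  obtain ⟨N, hN, hBN, hNU⟩ := h
  obtain ⟨N', hN', hsub⟩ := hc N (hN.mem_nhdsSet.2 hBN)
  obtain ⟨O, hO, hBO, hON⟩ := mem_nhdsSet_iff_exists.1 hN'
  refine ⟨O, hO, hBO, ?_⟩
  rintro _ ⟨hx, x, rfl⟩
  obtain ⟨y, hy, hyx⟩ := hNU ⟨hsub ⟨x, hON hx, rfl⟩, x, rfl⟩
  exact ⟨y, hy, by rw [B.env.smoothEmbedding.isEmbedding.injective hyx]⟩

/-- An abstract boundary point is strongly attached to `U` if its representatives are. -/
def AbstractBoundary.StronglyAttached (x : AbstractBoundary n M) (U : Set M) : Prop :=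
  Quotient.lift (fun B : BoundarySet n M ↦ B.StronglyAttached U)
    (fun B B' (h : B.Covers B' ∧ B'.Covers B) ↦
      propext ⟨fun H ↦ H.of_covers h.1, fun H ↦ H.of_covers h.2⟩) x.1

variable (n M) in
/-- The set `M ∪ 𝓑(M)`. -/
def ExtendedSpace : Type (u + 1) := M ⊕ AbstractBoundary n M

variable (n) in
/-- The inclusion of `M` in `M ∪ 𝓑(M)`. -/
def ExtendedSpace.ofPoint (x : M) : ExtendedSpace n M := Sum.inl x

/-- The inclusion of `𝓑(M)` in `M ∪ 𝓑(M)`. -/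
def ExtendedSpace.ofBoundary (x : AbstractBoundary n M) : ExtendedSpace n M := Sum.inr x

variable (n M) in
/-- The strongly attached point topology on `M ∪ 𝓑(M)`, with basis the sets `U ∪ 𝓑_U` where `U`
is open in `M` and `𝓑_U` is the set of abstract boundary points strongly attached to `U`. -/
instance ExtendedSpace.topology : TopologicalSpace (ExtendedSpace n M) :=
  TopologicalSpace.generateFrom {W | ∃ U : Set M, IsOpen U ∧
    W = ofPoint n '' U ∪ ofBoundary '' {x | x.StronglyAttached U}}

/-! ### Classification of boundary points -/

/-- The curve `γ` approaches the boundary point `p`: `φ ∘ γ` has `p` as a limit point at its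
end. -/
def BoundaryPoint.IsApproachedBy (p : BoundaryPoint n M) (γ : ParamCurve M) : Prop :=
  MapClusterPt p.pt γ.toEnd (fun t ↦ p.env.map (γ t))

/-- `p` is approachable, and every curve of the family approaching `p` has unbounded
parameter. -/
def BoundaryPoint.IsPointAtInfinity (C : Set (ParamCurve M)) (p : BoundaryPoint n M) : Prop :=
  (∃ γ ∈ C, p.IsApproachedBy γ) ∧ ∀ γ ∈ C, p.IsApproachedBy γ → ¬ γ.HasBoundedParameter

/-- Some curve of the family approaches `p` with bounded parameter. -/
def BoundaryPoint.IsSingular (C : Set (ParamCurve M)) (p : BoundaryPoint n M) : Prop :=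
  ∃ γ ∈ C, p.IsApproachedBy γ ∧ γ.HasBoundedParameter

/-- A singular boundary point is a pure singularity if it covers no point at infinity (of any
envelopment). -/
def BoundaryPoint.IsPureSingularity (C : Set (ParamCurve M)) (p : BoundaryPoint n M) : Prop :=
  p.IsSingular C ∧ ¬ ∃ q : BoundaryPoint n M, q.IsPointAtInfinity C ∧ p.toSet.Covers q.toSet

/-- Pure singularities among the abstract boundary points. -/
def AbstractBoundary.IsPureSingularity (C : Set (ParamCurve M)) (x : AbstractBoundary n M) :
    Prop :=
  ∃ p : BoundaryPoint n M, p.toAbstract = x ∧ p.IsPureSingularity C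

end AbstractBoundary

/-! ### The black region -/

section BlackRegion

variable {n : ℕ} {r : ℕ∞} {M : Type u} [TopologicalSpace M]
  [ChartedSpace (EuclideanSpace ℝ (Fin n)) M]

variable (n) in
/-- An open set to which every pure singularity is strongly attached. -/
def IsSingularNeighborhood (C : Set (ParamCurve M)) (U : Set M) : Prop :=
  IsOpen U ∧ ∀ x : AbstractBoundary n M, x.IsPureSingularity C → x.StronglyAttached U

variable (n) in
/-- A closed set `A` such that `A \ U` is compact for every singular neighbourhood `U`. -/
def IsSingularlyCompact (C : Set (ParamCurve M)) (A : Set M) : Prop :=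
  IsClosed A ∧ ∀ U : Set M, IsSingularNeighborhood n C U → IsCompact (A \ U)

/-- The black region: the union of all singularly compact future sets. -/
def blackRegion [IsManifold (𝓡 n) ∞ M] {g : LorentzMetric n r M} (τ : TimeOrientation g)
    (C : Set (ParamCurve M)) : Set M :=
  ⋃₀ {A | IsSingularlyCompact n C A ∧ causalFuture τ A = A}

end BlackRegion

/-! ### Immersions in equal dimension -/

/-! Suppose that no pure singularity is an accumulation point of the sequence, and let `S` be its
range. By strong causality a cluster point of the sequence in `M` would be an end point of `σ`, so
there is none, and `S` is closed. A pure singularity `x` is strongly attached to an open set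
containing only finitely many terms of the sequence. Deleting those terms keeps `x` attached, so `x`
is attached to `Sᶜ` (`stronglyAttached_compl_range`). Thus `Sᶜ` is a singular neighbourhood, and for
a singularly compact future set `A` containing `p` the set `A \ Sᶜ = A ∩ S` is compact. It contains
all late terms of the sequence, which must then cluster in `M`: a contradiction.

Deleting finitely many points is harmless because `φ(M)` is open, hence disjoint from its frontier;
this is where equal dimension enters. -/

theorem isOpen_range_of_isImmersion {n : ℕ} {M N : Type*}
    [TopologicalSpace M] [ChartedSpace (EuclideanSpace ℝ (Fin n)) M]
    [TopologicalSpace N] [ChartedSpace (EuclideanSpace ℝ (Fin n)) N]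
    {k : ℕ∞ω} {f : M → N} (hf : IsImmersion (𝓡 n) (𝓡 n) k f) : IsOpen (range f) := by
  obtain ⟨F, _, _, hF⟩ := hf
  rw [isOpen_iff_mem_nhds]
  rintro _ ⟨x, rfl⟩
  have h := hF x
  -- In adapted charts `f` is `u ↦ h.equiv (u, 0)`, an injective linear map. Equal finite dimension
  -- makes it surjective, hence open.
  let L : EuclideanSpace ℝ (Fin n) →L[ℝ] EuclideanSpace ℝ (Fin n) :=
    (h.equiv : (EuclideanSpace ℝ (Fin n) × F) →L[ℝ] EuclideanSpace ℝ (Fin n)).comp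
      (ContinuousLinearMap.inl ℝ _ F)
  have hinj : Function.Injective L :=
    h.equiv.injective.comp (Prod.mk_left_injective (0 : F))
  have hsurj : Function.Surjective L :=
    (LinearMap.injective_iff_surjective (f := L.toLinearMap)).1 hinj
  have hw : ∀ u ∈ h.domChart.target, h.codChart (f (h.domChart.symm u)) = L u := by
    intro u hu
    have hu' : u ∈ (h.domChart.extend (𝓡 n)).target := by simpa using hu
    simpa [L] using h.writtenInCharts hu'
  have hopen : IsOpen (L '' h.domChart.target) :=
    L.isOpenMap hsurj _ h.domChart.open_target
  refine mem_of_superset ((h.codChart.isOpen_inter_preimage hopen).mem_nhds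
    ⟨h.mem_codChart_source, h.domChart x, h.domChart.map_source h.mem_domChart_source, ?_⟩) ?_
  · rw [← hw _ (h.domChart.map_source h.mem_domChart_source),
      h.domChart.left_inv h.mem_domChart_source]
  · rintro y ⟨hy, u, hu, huy⟩
    exact ⟨h.domChart.symm u, h.codChart.injOn
      (h.source_subset_preimage_source (h.domChart.map_target hu)) hy ((hw u hu).trans huy)⟩

/-! ### Causal curves -/

section Causal

variable {n : ℕ} {r : ℕ∞} {M : Type*} [TopologicalSpace M]
  [ChartedSpace (EuclideanSpace ℝ (Fin n)) M] [IsManifold (𝓡 n) ∞ M] {g : LorentzMetric n r M}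
  {τ : TimeOrientation g}

theorem IsFutureCausalOn.mono {σ : ℝ → M} {s s' : Set ℝ} (h : IsFutureCausalOn τ σ s)
    (hs : s' ⊆ s) : IsFutureCausalOn τ σ s' := by
  obtain ⟨hc, F, hF, hσ⟩ := h
  exact ⟨hc.mono hs, F, fun c hc d hd ↦ hF c (hs hc) d (hs hd),
    fun c hc d hd ↦ hσ c (hs hc) d (hs hd)⟩

theorem ParamCurve.ext_coe {M : Type*} (γ : ParamCurve M) (t : γ.dom) : γ.ext t = γ t := by
  simp only [ParamCurve.ext, t.2, dif_pos, Subtype.coe_eta]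

theorem ParamCurve.Icc_subset_dom {M : Type*} (γ : ParamCurve M) (s t : γ.dom) :
    Icc (s : ℝ) t ⊆ γ.dom := fun _ hx ↦
  ⟨s.2.1.trans hx.1, lt_of_le_of_lt (EReal.coe_le_coe_iff.2 hx.2) t.2.2⟩

theorem ParamCurve.eventually_gt_toEnd {M : Type*} (γ : ParamCurve M) (s : γ.dom) :
    ∀ᶠ t in γ.toEnd, s < t := by
  filter_upwards [preimage_mem_comap (Ioi_mem_nhds s.2.2)] with t ht
  exact EReal.coe_lt_coe_iff.1 ht

theorem causalFuture_of_curve {σ : ParamCurve M} (hσ : IsFutureCausalOn τ σ.ext σ.dom)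
    {A : Set M} {s t : σ.dom} (hst : s < t) (hs : σ s ∈ A) : σ t ∈ causalFuture τ A :=
  ⟨σ s, hs, Or.inr ⟨σ.ext, s, t, hst, hσ.mono (σ.Icc_subset_dom s t), σ.ext_coe s, σ.ext_coe t⟩⟩

/-- In a strongly causal spacetime a future-directed causal curve converges to each of its limit
points. -/
theorem IsStronglyCausal.tendsto_of_mapClusterPt (hsc : IsStronglyCausal τ) {σ : ParamCurve M}
    (hσ : IsFutureCausalOn τ σ.ext σ.dom) {t : ℕ → σ.dom} (ht : Tendsto t atTop σ.toEnd)
    {q : M} (hq : MapClusterPt q atTop fun k ↦ σ (t k)) : Tendsto σ σ.toEnd (𝓝 q) := by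
  intro U hU
  obtain ⟨V, hV, -, hVU⟩ := hsc q U hU
  have hfreq : ∃ᶠ k in atTop, σ (t k) ∈ V := mapClusterPt_iff_frequently.1 hq V hV
  obtain ⟨j, hj⟩ := hfreq.exists
  rw [mem_map]
  filter_upwards [σ.eventually_gt_toEnd (t j)] with s hs
  rw [mem_preimage]
  -- The curve returns to `V` after `s`, so `s` lies between two visits to `V` and `σ s` cannot have
  -- left `U`.
  obtain ⟨k, hk, hsk⟩ := (hfreq.and_eventually (ht (σ.eventually_gt_toEnd s))).exists
  have hmem := hVU σ.ext (t j) (t k) (hs.trans hsk)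
    (hσ.mono (σ.Icc_subset_dom (t j) (t k))) (by rwa [σ.ext_coe]) (by rwa [σ.ext_coe])
    s ⟨hs.le, le_of_lt hsk⟩
  rwa [σ.ext_coe] at hmem

end Causal

/-! ### The strongly attached point topology -/

section AbstractBoundary

variable {n : ℕ} {M : Type u} [TopologicalSpace M] [ChartedSpace (EuclideanSpace ℝ (Fin n)) M]

theorem Envelopment.isOpen_range (φ : Envelopment n M) : IsOpen (range φ.map) :=
  isOpen_range_of_isImmersion φ.smoothEmbedding.isImmersion

namespace BoundarySet.StronglyAttached

variable {B : BoundarySet n M} {U V : Set M}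

theorem mono (h : B.StronglyAttached U) (hUV : U ⊆ V) : B.StronglyAttached V := by
  obtain ⟨N, hN, hBN, hNU⟩ := h
  exact ⟨N, hN, hBN, hNU.trans (image_mono hUV)⟩

theorem inter (hU : B.StronglyAttached U) (hV : B.StronglyAttached V) :
    B.StronglyAttached (U ∩ V) := by
  obtain ⟨N, hN, hBN, hNU⟩ := hU
  obtain ⟨N', hN', hBN', hNV⟩ := hV
  refine ⟨N ∩ N', hN.inter hN', subset_inter hBN hBN', ?_⟩
  rw [image_inter B.env.smoothEmbedding.isEmbedding.injective]
  exact fun y hy ↦ ⟨hNU ⟨hy.1.1, hy.2⟩, hNV ⟨hy.1.2, hy.2⟩⟩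

end BoundarySet.StronglyAttached

theorem BoundarySet.stronglyAttached_univ (B : BoundarySet n M) : B.StronglyAttached univ :=
  ⟨univ, isOpen_univ, subset_univ _, by simp⟩

/-- The finite set `φ(S)` is closed and, as `φ(M)` is open, misses the frontier; its complement is
therefore a neighbourhood of `B`. -/
theorem BoundarySet.stronglyAttached_compl_of_finite (B : BoundarySet n M) {S : Set M}
    (hS : S.Finite) : B.StronglyAttached Sᶜ := by
  refine ⟨(B.env.map '' S)ᶜ, (hS.image _).isClosed.isOpen_compl, ?_, ?_⟩
  · rintro x hx ⟨y, -, rfl⟩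
    have hfr := B.subset hx
    rw [B.env.isOpen_range.frontier_eq] at hfr
    exact hfr.2 (mem_range_self y)
  · rintro _ ⟨hx, x, rfl⟩
    exact ⟨x, fun h ↦ hx ⟨x, h, rfl⟩, rfl⟩

namespace AbstractBoundary

/-- One representative serves all `U` at once, so properties relating several sets, such as
stability under intersection, pass to the quotient. -/
theorem stronglyAttached_iff (x : AbstractBoundary n M) :
    ∃ B : BoundarySet n M, ∀ U : Set M, x.StronglyAttached U ↔ B.StronglyAttached U := by
  obtain ⟨_, p, rfl⟩ := x
  exact ⟨p.toSet, fun _ ↦ Iff.rfl⟩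

variable {x : AbstractBoundary n M} {U V : Set M}

theorem StronglyAttached.mono (h : x.StronglyAttached U) (hUV : U ⊆ V) :
    x.StronglyAttached V := by
  obtain ⟨B, hB⟩ := x.stronglyAttached_iff
  exact (hB V).2 (((hB U).1 h).mono hUV)

theorem StronglyAttached.inter (hU : x.StronglyAttached U) (hV : x.StronglyAttached V) :
    x.StronglyAttached (U ∩ V) := by
  obtain ⟨B, hB⟩ := x.stronglyAttached_iff
  exact (hB _).2 (((hB U).1 hU).inter ((hB V).1 hV))

theorem stronglyAttached_univ (x : AbstractBoundary n M) : x.StronglyAttached univ := by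
  obtain ⟨B, hB⟩ := x.stronglyAttached_iff
  exact (hB _).2 B.stronglyAttached_univ

theorem stronglyAttached_compl_of_finite (x : AbstractBoundary n M) {S : Set M} (hS : S.Finite) :
    x.StronglyAttached Sᶜ := by
  obtain ⟨B, hB⟩ := x.stronglyAttached_iff
  exact (hB _).2 (B.stronglyAttached_compl_of_finite hS)

end AbstractBoundary

namespace ExtendedSpace

variable {x : AbstractBoundary n M}

theorem ofBoundary_mem_basic {U : Set M} :
    ofBoundary x ∈ ofPoint n '' U ∪ ofBoundary '' {x | x.StronglyAttached U} ↔
      x.StronglyAttached U := by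
  refine ⟨?_, fun h ↦ Or.inr ⟨x, h, rfl⟩⟩
  rintro (⟨y, -, hy⟩ | ⟨y, hy, hyx⟩)
  · exact (Sum.inl_ne_inr hy).elim
  · rwa [← Sum.inr_injective hyx]

/-- The sets strongly attached to `x` are traces of neighbourhoods of `x`, up to passing to
smaller sets. -/
theorem exists_stronglyAttached_of_mem_nhds {W : Set (ExtendedSpace n M)}
    (hW : W ∈ 𝓝 (ofBoundary x)) :
    ∃ U : Set M, IsOpen U ∧ x.StronglyAttached U ∧ ofPoint n '' U ⊆ W := by
  obtain ⟨O, hOW, hO, hxO⟩ := mem_nhds_iff.1 hW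
  suffices h : ∃ U : Set M, IsOpen U ∧ x.StronglyAttached U ∧ ofPoint n '' U ⊆ O by
    obtain ⟨U, hU, hxU, hUO⟩ := h
    exact ⟨U, hU, hxU, hUO.trans hOW⟩
  clear hW hOW
  -- Induction on generated open sets; finite intersections reduce to stability of attachment under
  -- intersection.
  induction hO with
  | basic s hs =>
    obtain ⟨U, hU, rfl⟩ := hs
    exact ⟨U, hU, ofBoundary_mem_basic.1 hxO, subset_union_left⟩
  | univ => exact ⟨univ, isOpen_univ, x.stronglyAttached_univ, subset_univ _⟩
  | inter s t _ _ hs ht =>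
    obtain ⟨U, hU, hxU, hUs⟩ := hs hxO.1
    obtain ⟨V, hV, hxV, hVt⟩ := ht hxO.2
    exact ⟨U ∩ V, hU.inter hV, hxU.inter hxV, subset_inter
      ((image_mono inter_subset_left).trans hUs) ((image_mono inter_subset_right).trans hVt)⟩
  | sUnion S _ hS =>
    obtain ⟨s, hs, hxs⟩ := hxO
    obtain ⟨U, hU, hxU, hUs⟩ := hS s hs hxs
    exact ⟨U, hU, hxU, hUs.trans (subset_sUnion_of_mem hs)⟩

/-- A sequence in `M` which does not accumulate at an abstract boundary point `x` has a range to
whose complement `x` is strongly attached. -/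
theorem stronglyAttached_compl_range {u : ℕ → M}
    (hx : ¬ MapClusterPt (ofBoundary x) atTop fun k ↦ ofPoint n (u k)) :
    x.StronglyAttached (range u)ᶜ := by
  simp only [mapClusterPt_iff_frequently, not_forall, not_frequently] at hx
  obtain ⟨W, hW, hev⟩ := hx
  obtain ⟨U, -, hxU, hUW⟩ := exists_stronglyAttached_of_mem_nhds hW
  obtain ⟨K, hK⟩ := eventually_atTop.1 hev
  -- Only the terms with index below `K` can lie in `U`; remove them.
  refine (hxU.inter (x.stronglyAttached_compl_of_finite ((finite_Iio K).image u))).mono ?_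
  rintro _ ⟨hU, hfin⟩ ⟨k, rfl⟩
  rcases lt_or_ge k K with hk | hk
  · exact hfin ⟨k, hk, rfl⟩
  · exact hK k hk (hUW ⟨_, hU, rfl⟩)

end ExtendedSpace

end AbstractBoundary

/-- A point outside the range has a neighbourhood containing only finitely many terms, and these can
be removed in a T1 space. -/
theorem isClosed_range_of_forall_not_mapClusterPt {X : Type*} [TopologicalSpace X] [T1Space X]
    {u : ℕ → X} (h : ∀ q, ¬ MapClusterPt q atTop u) : IsClosed (range u) := by
  refine isOpen_compl_iff.1 (isOpen_iff_mem_nhds.2 fun q hq ↦ ?_)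
  have hq' := h q
  simp only [mapClusterPt_iff_frequently, not_forall, not_frequently] at hq'
  obtain ⟨W, hW, hev⟩ := hq'
  obtain ⟨K, hK⟩ := eventually_atTop.1 hev
  have hfin : (u '' Iio K).Finite := (finite_Iio K).image u
  filter_upwards [hW, hfin.isClosed.isOpen_compl.mem_nhds
    fun hmem ↦ hq (image_subset_range _ _ hmem)] with y hyW hy
  rintro ⟨k, rfl⟩
  rcases lt_or_ge k K with hk | hk
  · exact hy ⟨k, hk, rfl⟩
  · exact hK k hk hyW

theorem theorem5p8 {n : ℕ} {r : ℕ∞} {M : Type u} [TopologicalSpace M]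
    [ChartedSpace (EuclideanSpace ℝ (Fin n)) M] [IsManifold (𝓡 n) ∞ M]
    [ConnectedSpace M] [T2Space M] [ParacompactSpace M]
    (g : LorentzMetric n r M) (τ : TimeOrientation g)
    (C : Set (ParamCurve M)) (hC : HasBoundedParameterProperty n C)
    (hsc : IsStronglyCausal τ)
    (p : M) (hp : p ∈ blackRegion τ C)
    (σ : ParamCurve M) (hσ : IsFutureCausalOn τ σ.ext σ.dom) (hinext : σ.IsInextendible)
    (hpσ : ∃ t₀ : σ.dom, σ t₀ = p)
    (t : ℕ → σ.dom) (ht : Tendsto t atTop σ.toEnd) :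
    ∃ x : AbstractBoundary n M, x.IsPureSingularity C ∧
      MapClusterPt (ExtendedSpace.ofBoundary x) atTop
        (fun k ↦ ExtendedSpace.ofPoint n (σ (t k))) := by
  obtain ⟨A, ⟨⟨-, hA⟩, hJA⟩, hpA⟩ := hp
  obtain ⟨t₀, rfl⟩ := hpσ
  by_contra! hno
  have hclus : ∀ q : M, ¬ MapClusterPt q atTop fun k ↦ σ (t k) :=
    fun q hq ↦ hinext q (hsc.tendsto_of_mapClusterPt hσ ht hq)
  -- The complement of the range is a singular neighbourhood, and removing it from `A` leaves the
  -- terms that lie in `A`.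
  have hcpt : IsCompact (A \ (range fun k ↦ σ (t k))ᶜ) := hA _
    ⟨(isClosed_range_of_forall_not_mapClusterPt hclus).isOpen_compl,
      fun x hx ↦ ExtendedSpace.stronglyAttached_compl_range (hno x hx)⟩
  -- After the parameter `t₀` of `p` the curve stays in `J⁺(A) = A`.
  have hev : ∀ᶠ k in atTop, σ (t k) ∈ A \ (range fun k ↦ σ (t k))ᶜ := by
    filter_upwards [ht (σ.eventually_gt_toEnd t₀)] with k hk
    exact ⟨hJA ▸ causalFuture_of_curve hσ hk hpA, not_not.2 (mem_range_self k)⟩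
  obtain ⟨q, -, hq⟩ := hcpt.exists_clusterPt (tendsto_principal.2 hev)
  exact hclus q hq
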